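/- Let $\mathbb K=\mathbb R$ or $\mathbb C$, let $(\mathbf e_n)_{n\ge 1}$ be the canonical basis of $\ell^1=\ell^1(\mathbb K)$, put $$\mathbf x_n=\mathbf e_n-\tfrac12\big(\mathbf e_{2n}+\mathbf e_{2n+1}\big),\qquad n=1,2,\dots,$$ and let $D$ be the closed linear span of $\{\mathbf x_n\}_{n\ge1}$ in $\ell^1$. Then $\{\mathbf x_n\}$ (the Lindenstrauss basis) is a monotone Schauder basis of $D$; write $x=\sum_j a_j(x)\mathbf x_j$ for $x\in D$, and $S_A x=\sum_{j\in A}a_j(x)\mathbf x_j$ for finite $A\subset\mathbb N$. A greedy ordering of $x\in D$ is an injective map $\pi:\mathbb N\to\mathbb N$ whose range contains $\{j: a_j(x)\neq0\}$ and with $|a_{\pi(k)}(x)|\ge|a_{\pi(k+1)}(x)|$ for all $k$; put $G_N^\pi(x)=\sum_{k=1}^N a_{\pi(k)}(x)\mathbf x_{\pi(k)}$. Let $\sigma_N(x)=\inf\|x-y\|$ over all $y\in D$ with at most $N$ non-zero coefficients, and let $$k_N=\sup_{|A|\le N}\|S_A\|,\qquad C_N=\sup_{x,\pi}\frac{\|x-G^\pi_N(x)\|}{\sigma_N(x)},$$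 where the second supremum is over all $x\in D$ and all greedy orderings $\pi$ of $x$ (with $0/0=0$ and $a/0=\infty$ for $a>0$). Then: 1. $\{\mathbf x_n\}$ is quasi-greedy, that is, $G_N^\pi(x)\to x$ as $N\to\infty$ for every $x\in D$ and every greedy ordering $\pi$ of $x$; 2. $\{\mathbf x_n\}$ is democratic, that is, $$\sup_{n\ge1}\ \frac{\sup_{|A|=n}\|\sum_{j\in A}\mathbf x_j\|}{\inf_{|A|=n}\|\sum_{j\in A}\mathbf x_j\|}<\infty;$$ 3. $k_N\approx\log N$, that is, there are constants $c,C>0$ with $c\log N\le k_N\le C\log N$ for all $N\ge2$; 4. $C_N\approx\log N$, in the same sense, for all $N\ge2$. In particular $\{\mathbf x_n\}$ is not unconditional: some $x\in D$ has an expansion $\sum_j a_j(x)\mathbf x_j$ that does not converge unconditionally. -/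

import Mathlib

open Filter Topology
open scoped ENNReal lp

/-! ### Greedy approximation with respect to a Schauder basis -/

section Greedy

variable {𝕜 X : Type*} [RCLike 𝕜] [NormedAddCommGroup X] [NormedSpace 𝕜 X]

/-- `Σ_N`: the vectors with at most `N` non-null coefficients with respect to the basis `b`. -/
def nTermSet (b : SchauderBasis 𝕜 X) (N : ℕ) : Set X :=
  {y | ∃ A : Finset ℕ, A.card ≤ N ∧ ∀ i, i ∉ A → b.coord i y = 0}

/-- `σ_N(x) = inf {‖x - y‖ : y ∈ Σ_N}`, the `N`-term error of approximation. -/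
noncomputable def nTermError (b : SchauderBasis 𝕜 X) (N : ℕ) (x : X) : ℝ≥0∞ :=
  ⨅ y ∈ nTermSet b N, ‖x - y‖ₑ

/-- `π` enumerates, without repetitions, a set of indices that contains the support of `x`, in such
a way that the moduli of the coefficients of `x` are non-increasing. (One cannot ask `π` to be onto
`ℕ`: a vector with infinite support and some null coefficient would have no such enumeration.) -/
def IsGreedyOrdering (b : SchauderBasis 𝕜 X) (x : X) (π : ℕ → ℕ) : Prop :=
  Function.Injective π ∧ (∀ i, b.coord i x ≠ 0 → i ∈ Set.range π) ∧
    ∀ k, ‖b.coord (π (k + 1)) x‖ ≤ ‖b.coord (π k) x‖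

/-- `G_N^π(x)`, the sum of the first `N` terms of the expansion of `x` in the order given by `π`. -/
noncomputable def greedySum (b : SchauderBasis 𝕜 X) (π : ℕ → ℕ) (N : ℕ) (x : X) : X :=
  ∑ k ∈ Finset.range N, b.coord (π k) x • b (π k)

/-- `G_N^π(x) → x` for every vector `x` and every greedy ordering `π` of `x`. -/
def IsQuasiGreedy (b : SchauderBasis 𝕜 X) : Prop :=
  ∀ (x : X) (π : ℕ → ℕ), IsGreedyOrdering b x π →
    Tendsto (fun N => greedySum b π N x) atTop (𝓝 x)

/-- `h_l(n) = inf {‖∑_{j ∈ A} b_j‖ : |A| = n}`. -/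
noncomputable def leftDemocracy (b : SchauderBasis 𝕜 X) (n : ℕ) : ℝ≥0∞ :=
  ⨅ (A : Finset ℕ) (_ : A.card = n), ‖∑ j ∈ A, b j‖ₑ

/-- `h_r(n) = sup {‖∑_{j ∈ A} b_j‖ : |A| = n}`. -/
noncomputable def rightDemocracy (b : SchauderBasis 𝕜 X) (n : ℕ) : ℝ≥0∞ :=
  ⨆ (A : Finset ℕ) (_ : A.card = n), ‖∑ j ∈ A, b j‖ₑ

/-- `μ(N) = sup {h_r(n) / h_l(n) : 1 ≤ n ≤ N}`. -/
noncomputable def democracyRatio (b : SchauderBasis 𝕜 X) (N : ℕ) : ℝ≥0∞ :=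
  ⨆ n ∈ Finset.Icc 1 N, rightDemocracy b n / leftDemocracy b n

/-- The basis is democratic: `μ(N) = O(1)`. -/
def IsDemocratic (b : SchauderBasis 𝕜 X) : Prop :=
  ∃ C : ℝ, ∀ N : ℕ, democracyRatio b N ≤ ENNReal.ofReal C

/-- `k_N = sup {‖S_A‖ : |A| ≤ N}`, where `S_A` is the coordinate projection onto the set `A` of
indices and `‖S_A‖` is its operator norm. -/
noncomputable def projectionConst (b : SchauderBasis 𝕜 X) (N : ℕ) : ℝ≥0∞ :=
  ⨆ (A : Finset ℕ) (_ : A.card ≤ N), ‖GeneralSchauderBasis.proj b A‖ₑ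

/-- `C_N = sup ‖x - G_N^π(x)‖ / σ_N(x)`, over all vectors `x` and all greedy orderings `π` of `x`.
The quotient is taken in `[0, ∞]`, where `0 / 0 = 0` and `a / 0 = ∞` for `a > 0`. -/
noncomputable def lebesgueConst (b : SchauderBasis 𝕜 X) (N : ℕ) : ℝ≥0∞ :=
  ⨆ (x : X) (π : ℕ → ℕ) (_ : IsGreedyOrdering b x π),
    ‖x - greedySum b π N x‖ₑ / nTermError b N x

/-- `u_N ≈ log N` for `N ≥ 2`: the quotient lies between two positive constants. -/
def ApproxLog (u : ℕ → ℝ≥0∞) : Prop :=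
  ∃ c C : ℝ, 0 < c ∧ 0 < C ∧ ∀ N : ℕ, 2 ≤ N →
    ENNReal.ofReal (c * Real.log N) ≤ u N ∧ u N ≤ ENNReal.ofReal (C * Real.log N)

end Greedy

/-! ### The Lindenstrauss basis -/

section Lindenstrauss

variable (𝕜 : Type*) [RCLike 𝕜]

/-- The canonical unit vector `e_n` of `ℓ¹`. -/
noncomputable def unitVec (n : ℕ) : ℓ¹(ℕ, 𝕜) := lp.single 1 n (1 : 𝕜)

/-- `x_n = e_n - (e_{2n} + e_{2n+1}) / 2`. Only the indices `n = 1, 2, …` are used, so that all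
vectors below live on the coordinates `1, 2, …` and the coordinate `0` plays no role. -/
noncomputable def lindenstraussVec (n : ℕ) : ℓ¹(ℕ, 𝕜) :=
  unitVec 𝕜 n - (1 / 2 : 𝕜) • (unitVec 𝕜 (2 * n) + unitVec 𝕜 (2 * n + 1))

/-- The closed linear span `D` of `x_1, x_2, …` in `ℓ¹`, with the norm of `ℓ¹`. -/
noncomputable abbrev lindenstraussSpace : Submodule 𝕜 ℓ¹(ℕ, 𝕜) :=
  (Submodule.span 𝕜 (Set.range fun n : ℕ => lindenstraussVec 𝕜 (n + 1))).topologicalClosure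

end Lindenstrauss

section Lindenstrauss

variable {𝕜 : Type*} [RCLike 𝕜]

/-! ### Sums over binary trees -/

/-! View `m ≥ 1` as a node of the binary tree with parent `m / 2`. If `a m` are the coefficients of
`x` in `D`, then `x m = a m - a (m / 2) / 2` with `a 0 = 0`, so `‖x‖ = ∑ |a m - a (m / 2) / 2|`. As
each node has two children, passing a quantity to the children with weight `1/2` preserves its sum;
most estimates rest on this.

Upper bounds. Iterating `|a m| ≤ |x m| + |a (m / 2)| / 2` for `L` generations costs one `‖x‖` per
generation, so `2 ^ L` coefficients have total size at most `(L + 1) ‖x‖` (`sum_norm_treeCoeff_le`).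
Since `‖x_n‖ ≤ 2`, this bounds `k_N`, and by exchanging missed coefficients for excess ones also
`C_N`. For a greedy set the logarithm disappears: a selected node whose parent is not selected
satisfies `|x m| ≥ |a m| / 2`, and what selected parents contribute telescopes
(`norm_proj_le_of_greedy`).

Lower bounds. Weights `2⁻ᵈ` at depth `d < L` cancel except at the root and just below the last
level, giving norm at most `2` (`norm_treeVec_le`). Keeping only even depths destroys every
cancellation: each of the `L` levels contributes `1` (`le_norm_of_coord_even`). Hence `k_N` is at
least of order `L`. Raising the odd-depth coefficients to `2` makes the greedy algorithm remove
exactly these, hence `C_N` is too. Unbounded `k_N` excludes unconditionality. -/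

lemma sum_range_mul_div {M : Type*} [AddCommMonoid M] (f : ℕ → M) {d : ℕ} (hd : 0 < d) (n : ℕ) :
    ∑ m ∈ Finset.range (d * n), f (m / d) = d • ∑ m ∈ Finset.range n, f m := by
  induction n with
  | zero => simp
  | succ n ih =>
    rw [Nat.mul_succ, Finset.sum_range_add, ih, Finset.sum_range_succ, smul_add]
    congr 1
    rw [Finset.sum_congr rfl (g := fun _ => f n), Finset.sum_const, Finset.card_range]
    intro k hk
    rw [Nat.mul_add_div hd, Nat.div_eq_of_lt (Finset.mem_range.1 hk), add_zero]

/-! ### The norm of `ℓ¹` -/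

lemma hasSum_norm_l1 (x : ℓ¹(ℕ, 𝕜)) : HasSum (fun m => ‖x m‖) ‖x‖ := by
  simpa using lp.hasSum_norm (p := 1) (by simp) x

lemma sum_norm_apply_le (x : ℓ¹(ℕ, 𝕜)) (s : Finset ℕ) : ∑ m ∈ s, ‖x m‖ ≤ ‖x‖ :=
  sum_le_hasSum s (fun _ _ => norm_nonneg _) (hasSum_norm_l1 x)

/-- Ranges of even length consist of complete sibling pairs, so halving maps them two-to-one onto
`range n`. -/
lemma norm_le_of_sum_range_two_mul_le {x : ℓ¹(ℕ, 𝕜)} {C : ℝ}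
    (h : ∀ n, ∑ m ∈ Finset.range (2 * n), ‖x m‖ ≤ C) : ‖x‖ ≤ C := by
  refine le_of_tendsto (hasSum_norm_l1 x).tendsto_sum_nat (Eventually.of_forall fun n => ?_)
  refine le_trans (Finset.sum_le_sum_of_subset_of_nonneg ?_ fun _ _ _ => norm_nonneg _) (h n)
  exact Finset.range_subset_range.2 (by omega)

lemma norm_eq_sum_range {x : ℓ¹(ℕ, 𝕜)} {n : ℕ} (h : ∀ m, n ≤ m → x m = 0) :
    ‖x‖ = ∑ m ∈ Finset.range n, ‖x m‖ := by
  refine (hasSum_norm_l1 x).unique (hasSum_sum_of_ne_finset_zero fun m hm => ?_)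
  rw [h m (by simpa using hm), norm_zero]

/-! ### The coefficient functionals -/

lemma lindenstraussVec_apply (n m : ℕ) :
    lindenstraussVec 𝕜 n m = (if m = n then 1 else 0) - 1 / 2 * (if m / 2 = n then 1 else 0) := by
  simp only [lindenstraussVec, unitVec, lp.coeFn_sub, lp.coeFn_smul, lp.coeFn_add, Pi.sub_apply,
    Pi.smul_apply, Pi.add_apply, lp.single_apply, Pi.single_apply, smul_eq_mul]
  congr 2
  by_cases h : m / 2 = n
  · rcases Nat.mod_two_eq_zero_or_one m with h' | h'
    · rw [if_pos h, if_pos (by omega), if_neg (by omega), add_zero]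
    · rw [if_pos h, if_neg (by omega), if_pos (by omega), zero_add]
  · rw [if_neg h, if_neg (by omega), if_neg (by omega), add_zero]

/-- Evaluation at a coordinate, as a functional on `ℓ¹`. -/
noncomputable def evalL1 (m : ℕ) : ℓ¹(ℕ, 𝕜) →L[𝕜] 𝕜 := lp.evalCLM 𝕜 (fun _ : ℕ => 𝕜) 1 m

/-- The functional `x ↦ ∑ k, 2⁻ᵏ x(⌊m / 2ᵏ⌋)`, which gives the coefficient of index `m` with respect
to the Lindenstrauss basis. -/
noncomputable def treeCoeff : ℕ → (ℓ¹(ℕ, 𝕜) →L[𝕜] 𝕜)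
  | 0 => 0
  | n + 1 => evalL1 (n + 1) + (1 / 2 : 𝕜) • treeCoeff ((n + 1) / 2)
  decreasing_by omega

@[simp] lemma treeCoeff_zero (x : ℓ¹(ℕ, 𝕜)) : treeCoeff 0 x = 0 := by simp [treeCoeff]

lemma treeCoeff_of_pos {m : ℕ} (hm : 0 < m) (x : ℓ¹(ℕ, 𝕜)) :
    treeCoeff m x = x m + 1 / 2 * treeCoeff (m / 2) x := by
  obtain ⟨n, rfl⟩ := Nat.exists_eq_add_of_lt hm
  rw [zero_add, treeCoeff]
  rfl

lemma apply_eq_treeCoeff_sub {x : ℓ¹(ℕ, 𝕜)} (hx : x 0 = 0) (m : ℕ) :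
    x m = treeCoeff m x - 1 / 2 * treeCoeff (m / 2) x := by
  rcases Nat.eq_zero_or_pos m with rfl | hm
  · simp [hx]
  · rw [treeCoeff_of_pos hm]; ring

lemma treeCoeff_lindenstraussVec {n : ℕ} (hn : 0 < n) (m : ℕ) :
    treeCoeff m (lindenstraussVec 𝕜 n) = if m = n then 1 else 0 := by
  induction m using Nat.strong_induction_on with
  | _ m ih =>
    rcases Nat.eq_zero_or_pos m with rfl | hm
    · rw [treeCoeff_zero, if_neg (by omega)]
    · rw [treeCoeff_of_pos hm, ih _ (by omega), lindenstraussVec_apply]; ring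

lemma norm_treeCoeff_le (m : ℕ) (x : ℓ¹(ℕ, 𝕜)) :
    ‖treeCoeff m x‖ ≤ ‖x m‖ + 1 / 2 * ‖treeCoeff (m / 2) x‖ := by
  rcases Nat.eq_zero_or_pos m with rfl | hm
  · simp
  · rw [treeCoeff_of_pos hm]
    refine (norm_add_le _ _).trans_eq ?_
    rw [norm_mul]; simp

/-- The ancestors of `m` are distinct indices, so the partial sum up to `m / 2` leaves room for `‖x
m‖`. -/
lemma norm_treeCoeff_le_norm (m : ℕ) (x : ℓ¹(ℕ, 𝕜)) : ‖treeCoeff m x‖ ≤ ‖x‖ := by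
  refine le_trans ?_ (sum_norm_apply_le x (Finset.range (m + 1)))
  induction m using Nat.strong_induction_on with
  | _ m ih =>
    rcases Nat.eq_zero_or_pos m with rfl | hm
    · simp
    · refine (norm_treeCoeff_le m x).trans ?_
      have h := ih (m / 2) (by omega)
      have h2 : ∑ k ∈ Finset.range (m / 2 + 1), ‖x k‖ ≤ ∑ k ∈ Finset.range m, ‖x k‖ :=
        Finset.sum_le_sum_of_subset_of_nonneg (Finset.range_subset_range.2 (by omega))
          fun _ _ _ => norm_nonneg _
      rw [Finset.sum_range_succ]
      linarith [norm_nonneg (treeCoeff (m / 2) x)]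

/-- A set of `2ᴸ` coefficients has an `ℓ¹`-norm of at most `(L + 1) ‖x‖`. -/
lemma sum_norm_treeCoeff_le (x : ℓ¹(ℕ, 𝕜)) (A : Finset ℕ) {L : ℕ} (hA : A.card ≤ 2 ^ L) :
    ∑ m ∈ A, ‖treeCoeff m x‖ ≤ (L + 1) * ‖x‖ := by
  have key : ∀ k : ℕ, ∑ m ∈ A, ‖treeCoeff m x‖ ≤
      k * ‖x‖ + ∑ m ∈ A, (1 / 2 : ℝ) ^ k * ‖treeCoeff (m / 2 ^ k) x‖ := by
    intro k
    induction k with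
    | zero => simp
    | succ k ih =>
      have h1 : ∑ m ∈ A, (1 / 2 : ℝ) ^ k * ‖x (m / 2 ^ k)‖ ≤ ‖x‖ := by
        -- `A` is enlarged to complete blocks of length `2 ^ k`, on which `m / 2 ^ k` takes each
        -- value exactly `2 ^ k` times.
        have hsub : A ⊆ Finset.range (2 ^ k * (A.sup id + 1)) := fun m hm => by
          have h : m ≤ A.sup id := Finset.le_sup (f := id) hm
          have : 1 ≤ 2 ^ k := Nat.one_le_two_pow
          rw [Finset.mem_range]
          nlinarith
        refine (Finset.sum_le_sum_of_subset_of_nonneg hsub fun _ _ _ => by positivity).trans ?_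
        rw [← Finset.mul_sum, sum_range_mul_div (fun m => ‖x m‖) (by positivity), nsmul_eq_mul,
          ← mul_assoc]
        push_cast
        rw [← mul_pow]
        norm_num
        exact sum_norm_apply_le x _
      have h2 : ∑ m ∈ A, (1 / 2 : ℝ) ^ k * ‖treeCoeff (m / 2 ^ k) x‖ ≤
          ∑ m ∈ A, (1 / 2 : ℝ) ^ k * ‖x (m / 2 ^ k)‖ +
          ∑ m ∈ A, (1 / 2 : ℝ) ^ (k + 1) * ‖treeCoeff (m / 2 ^ (k + 1)) x‖ := by
        rw [← Finset.sum_add_distrib]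
        refine Finset.sum_le_sum fun m _ => ?_
        have h := norm_treeCoeff_le (m / 2 ^ k) x
        rw [Nat.div_div_eq_div_mul, ← pow_succ] at h
        rw [pow_succ (1 / 2 : ℝ), mul_assoc, ← mul_add]
        gcongr
      push_cast
      linarith
  refine (key L).trans ?_
  have h : ∑ m ∈ A, (1 / 2 : ℝ) ^ L * ‖treeCoeff (m / 2 ^ L) x‖ ≤ ‖x‖ := by
    calc _ ≤ ∑ _m ∈ A, (1 / 2 : ℝ) ^ L * ‖x‖ := by
          gcongr; exact norm_treeCoeff_le_norm _ x
      _ = A.card * ((1 / 2 : ℝ) ^ L * ‖x‖) := by rw [Finset.sum_const, nsmul_eq_mul]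
      _ ≤ (2 ^ L : ℕ) * ((1 / 2 : ℝ) ^ L * ‖x‖) := by gcongr
      _ = ‖x‖ := by
        push_cast
        rw [← mul_assoc, ← mul_pow]; norm_num
  linarith

/-! ### The basis -/

/-- The new term changes node `n + 1` by `c n`, losing at most `‖c n‖`, and puts `‖c n‖ / 2` on each
of its two children, where the earlier sum vanishes. -/
lemma norm_sum_smul_lindenstraussVec_mono (c : ℕ → 𝕜) :
    Monotone fun n => ‖∑ i ∈ Finset.range n, c i • lindenstraussVec 𝕜 (i + 1)‖ := by
  refine monotone_nat_of_le_succ fun n => ?_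
  set v := ∑ i ∈ Finset.range n, c i • lindenstraussVec 𝕜 (i + 1) with hv
  have hv0 : ∀ m, 2 * n + 2 ≤ m → v m = 0 := by
    intro m hm
    rw [hv, lp.coeFn_sum, Finset.sum_apply]
    refine Finset.sum_eq_zero fun i hi => ?_
    have := Finset.mem_range.1 hi
    rw [lp.coeFn_smul, Pi.smul_apply, lindenstraussVec_apply, if_neg (by omega),
      if_neg (by omega)]
    simp
  rw [Finset.sum_range_succ, ← hv]
  set w := v + c n • lindenstraussVec 𝕜 (n + 1) with hw
  have hwm : ∀ m, w m = v m + c n * ((if m = n + 1 then 1 else 0) -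
      1 / 2 * (if m / 2 = n + 1 then 1 else 0)) := by
    intro m
    rw [hw, lp.coeFn_add, Pi.add_apply, lp.coeFn_smul, Pi.smul_apply, lindenstraussVec_apply,
      smul_eq_mul]
  rw [norm_eq_sum_range hv0]
  refine le_trans ?_ (sum_norm_apply_le w (Finset.range (2 * n + 2 + 2)))
  rw [Finset.sum_range_succ _ (2 * n + 2 + 1), Finset.sum_range_succ _ (2 * n + 2)]
  have h1 : ‖w (2 * n + 2)‖ = 1 / 2 * ‖c n‖ := by
    rw [hwm, hv0 _ le_rfl, if_neg (by omega), if_pos (by omega), zero_add, norm_mul]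
    simp [mul_comm]
  have h2 : ‖w (2 * n + 2 + 1)‖ = 1 / 2 * ‖c n‖ := by
    rw [hwm, hv0 _ (by omega), if_neg (by omega), if_pos (by omega), zero_add, norm_mul]
    simp [mul_comm]
  have h3 : ∑ m ∈ Finset.range (2 * n + 2), ‖v m‖ ≤
      ∑ m ∈ Finset.range (2 * n + 2), (‖w m‖ + if m = n + 1 then ‖c n‖ else 0) := by
    refine Finset.sum_le_sum fun m hm => ?_
    have := Finset.mem_range.1 hm
    rw [hwm, if_neg (show ¬ m / 2 = n + 1 by omega)]
    split_ifs with h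
    · have := norm_sub_le (v m + c n * (1 - 1 / 2 * 0)) (c n)
      simpa using this
    · simp
  rw [Finset.sum_add_distrib, Finset.sum_ite_eq', if_pos (Finset.mem_range.2 (by omega))] at h3
  linarith

/-- The partial sum operators of the Lindenstrauss basis, extended to `ℓ¹`. -/
noncomputable def lindenstraussPartialSum (n : ℕ) : ℓ¹(ℕ, 𝕜) →L[𝕜] ℓ¹(ℕ, 𝕜) :=
  ∑ i ∈ Finset.range n, (treeCoeff (i + 1)).smulRight (lindenstraussVec 𝕜 (i + 1))

lemma lindenstraussPartialSum_apply (n : ℕ) (x : ℓ¹(ℕ, 𝕜)) :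
    lindenstraussPartialSum n x =
      ∑ i ∈ Finset.range n, treeCoeff (i + 1) x • lindenstraussVec 𝕜 (i + 1) := by
  simp [lindenstraussPartialSum]

lemma eventually_lindenstraussPartialSum_eq {x : ℓ¹(ℕ, 𝕜)}
    (hx : x ∈ Submodule.span 𝕜 (Set.range fun n : ℕ => lindenstraussVec 𝕜 (n + 1))) :
    ∀ᶠ n in atTop, lindenstraussPartialSum n x = x := by
  induction hx using Submodule.span_induction with
  | mem x h =>
    obtain ⟨k, rfl⟩ := h
    filter_upwards [eventually_gt_atTop k] with n hn
    rw [lindenstraussPartialSum_apply, Finset.sum_eq_single_of_mem k (Finset.mem_range.2 hn)]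
    · rw [treeCoeff_lindenstraussVec k.succ_pos, if_pos rfl, one_smul]
    · intro i _ hi
      rw [treeCoeff_lindenstraussVec k.succ_pos, if_neg (by omega), zero_smul]
  | zero => simp
  | add x y _ _ hx hy =>
    filter_upwards [hx, hy] with n h1 h2
    rw [map_add, h1, h2]
  | smul c x _ hx =>
    filter_upwards [hx] with n h
    rw [map_smul, h]

/-- On the span, `y` is one of its own later partial sums, so monotonicity applies; the inequality
passes to the closure. -/
lemma norm_lindenstraussPartialSum_le {x : ℓ¹(ℕ, 𝕜)} (hx : x ∈ lindenstraussSpace 𝕜) (n : ℕ) :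
    ‖lindenstraussPartialSum n x‖ ≤ ‖x‖ := by
  have hcl : IsClosed {y : ℓ¹(ℕ, 𝕜) | ‖lindenstraussPartialSum n y‖ ≤ ‖y‖} :=
    isClosed_le (by fun_prop) (by fun_prop)
  refine closure_minimal (fun y hy => ?_) hcl hx
  obtain ⟨k, hk, hkn⟩ := ((eventually_lindenstraussPartialSum_eq hy).and
    (eventually_ge_atTop n)).exists
  change ‖lindenstraussPartialSum n y‖ ≤ ‖y‖
  nth_rw 2 [← hk]
  rw [lindenstraussPartialSum_apply, lindenstraussPartialSum_apply]
  exact norm_sum_smul_lindenstraussVec_mono (fun i => treeCoeff (i + 1) y) hkn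

lemma tendsto_lindenstraussPartialSum {x : ℓ¹(ℕ, 𝕜)} (hx : x ∈ lindenstraussSpace 𝕜) :
    Tendsto (fun n => lindenstraussPartialSum n x) atTop (𝓝 x) := by
  refine Metric.tendsto_atTop'.2 fun ε hε => ?_
  obtain ⟨y, hy, hxy⟩ := Metric.mem_closure_iff.1 hx (ε / 2) (half_pos hε)
  obtain ⟨N, hN⟩ := eventually_atTop.1 (eventually_lindenstraussPartialSum_eq hy)
  refine ⟨N, fun n hn => ?_⟩
  have hyD : y ∈ lindenstraussSpace 𝕜 := Submodule.le_topologicalClosure _ hy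
  have h := norm_lindenstraussPartialSum_le (sub_mem hx hyD) n
  rw [map_sub, hN n hn.le] at h
  rw [dist_eq_norm] at hxy ⊢
  calc ‖lindenstraussPartialSum n x - x‖ = ‖(lindenstraussPartialSum n x - y) - (x - y)‖ := by
        congr 1; abel
    _ ≤ ‖lindenstraussPartialSum n x - y‖ + ‖x - y‖ := norm_sub_le _ _
    _ < ε := by linarith

/-- Index `0` is its own half, so the parent relation holds there only because members of `D` vanish
at it. -/
lemma apply_zero_of_mem_lindenstraussSpace {x : ℓ¹(ℕ, 𝕜)} (hx : x ∈ lindenstraussSpace 𝕜) :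
    x 0 = 0 := by
  refine tendsto_nhds_unique (((evalL1 (𝕜 := 𝕜) 0).continuous.tendsto x).comp
    (tendsto_lindenstraussPartialSum hx)) (tendsto_const_nhds.congr fun n => ?_)
  change 0 = lindenstraussPartialSum n x 0
  rw [lindenstraussPartialSum_apply, lp.coeFn_sum, Finset.sum_apply]
  refine (Finset.sum_eq_zero fun i _ => ?_).symm
  simp [lindenstraussVec_apply]

/-- The Lindenstrauss basis of the closed linear span of its vectors. -/
noncomputable def lindenstraussBasis : SchauderBasis 𝕜 (lindenstraussSpace 𝕜) where
  basis i := ⟨lindenstraussVec 𝕜 (i + 1),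
    Submodule.le_topologicalClosure _ (Submodule.subset_span ⟨i, rfl⟩)⟩
  coord i := (treeCoeff (i + 1)).comp (lindenstraussSpace 𝕜).subtypeL
  ortho i j := by
    change treeCoeff (i + 1) (lindenstraussVec 𝕜 (j + 1)) = _
    rw [treeCoeff_lindenstraussVec j.succ_pos]
    by_cases h : i = j
    · subst h; simp
    · simp [h]
  expansion x := by
    rw [HasSum, SummationFilter.conditional_filter_eq_map_range, tendsto_map'_iff,
      tendsto_subtype_rng]
    refine (tendsto_lindenstraussPartialSum x.2).congr fun n => ?_
    rw [lindenstraussPartialSum_apply]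
    simp

lemma coe_lindenstraussBasis (n : ℕ) :
    (lindenstraussBasis n : lindenstraussSpace 𝕜).1 = lindenstraussVec 𝕜 (n + 1) := rfl

lemma lindenstraussBasis_coord (n : ℕ) (x : lindenstraussSpace 𝕜) :
    lindenstraussBasis.coord n x = treeCoeff (n + 1) x.1 := rfl

lemma norm_lindenstraussBasis_proj_le (n : ℕ) :
    ‖SchauderBasis.proj (lindenstraussBasis (𝕜 := 𝕜)) n‖ ≤ 1 := by
  refine ContinuousLinearMap.opNorm_le_bound _ zero_le_one fun x => ?_
  rw [one_mul]
  refine le_trans (le_of_eq ?_) (norm_lindenstraussPartialSum_le x.2 n)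
  rw [SchauderBasis.proj_apply, lindenstraussPartialSum_apply, Submodule.coe_norm]
  simp [coe_lindenstraussBasis, lindenstraussBasis_coord]

end Lindenstrauss

/-! ### Greedy sums and coordinate projections for general Schauder bases -/

section Greedy

variable {𝕜 X : Type*} [RCLike 𝕜] [NormedAddCommGroup X] [NormedSpace 𝕜 X]

lemma coord_sum_smul (b : SchauderBasis 𝕜 X) (A : Finset ℕ) (c : ℕ → 𝕜) (k : ℕ) :
    b.coord k (∑ i ∈ A, c i • b i) = if k ∈ A then c k else 0 := by
  rw [map_sum, ← Finset.sum_ite_eq A k]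
  refine Finset.sum_congr rfl fun i _ => ?_
  rw [map_smul, b.ortho, smul_eq_mul]
  by_cases h : k = i
  · subst h; simp
  · simp [h]

lemma coord_proj (b : SchauderBasis 𝕜 X) (A : Finset ℕ) (x : X) (k : ℕ) :
    b.coord k (GeneralSchauderBasis.proj b A x) = if k ∈ A then b.coord k x else 0 := by
  rw [GeneralSchauderBasis.proj_apply, coord_sum_smul b A fun i => b.coord i x]

lemma proj_eq_self_of_coord_eq_zero (b : SchauderBasis 𝕜 X) {A : Finset ℕ} {y : X}
    (hy : ∀ i, i ∉ A → b.coord i y = 0) : GeneralSchauderBasis.proj b A y = y := by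
  refine tendsto_nhds_unique (tendsto_const_nhds.congr' ?_) (SchauderBasis.tendsto_proj b y)
  filter_upwards [eventually_gt_atTop (A.sup id)] with n hn
  rw [GeneralSchauderBasis.proj_apply, SchauderBasis.proj_apply]
  refine Finset.sum_subset (fun i hi => ?_) fun i _ hi => by rw [hy i hi, zero_smul]
  exact Finset.mem_range.2 ((Finset.le_sup (f := id) hi).trans_lt hn)

lemma greedySum_eq_proj (b : SchauderBasis 𝕜 X) {π : ℕ → ℕ} (hπ : Function.Injective π) (N : ℕ)
    (x : X) : greedySum b π N x =
      GeneralSchauderBasis.proj b ((Finset.range N).map ⟨π, hπ⟩) x := by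
  rw [GeneralSchauderBasis.proj_apply, Finset.sum_map]
  rfl

/-- An index missed by `π` has a null coefficient; any other is enumerated later than `i`. -/
lemma IsGreedyOrdering.norm_coord_le {b : SchauderBasis 𝕜 X} {x : X} {π : ℕ → ℕ}
    (h : IsGreedyOrdering b x π) {N i j : ℕ} (hi : i ∈ (Finset.range N).map ⟨π, h.1⟩)
    (hj : j ∉ (Finset.range N).map ⟨π, h.1⟩) : ‖b.coord j x‖ ≤ ‖b.coord i x‖ := by
  obtain ⟨k, hk, rfl⟩ := Finset.mem_map.1 hi
  by_cases h0 : b.coord j x = 0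
  · rw [h0, norm_zero]; exact norm_nonneg _
  · obtain ⟨l, rfl⟩ := h.2.1 j h0
    have hl : ¬ l < N := fun hl => hj (Finset.mem_map.2 ⟨l, Finset.mem_range.2 hl, rfl⟩)
    exact antitone_nat_of_succ_le (f := fun k => ‖b.coord (π k) x‖) h.2.2
      ((Finset.mem_range.1 hk).le.trans (not_lt.1 hl))

/-- A uniform bound for the projections onto greedy sets yields convergence of the greedy sums. -/
lemma isQuasiGreedy_of_norm_proj_le (b : SchauderBasis 𝕜 X) {C : ℝ}
    (hC : ∀ (x : X) (A : Finset ℕ), (∀ i ∈ A, ∀ j ∉ A, ‖b.coord j x‖ ≤ ‖b.coord i x‖) →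
      ‖GeneralSchauderBasis.proj b A x‖ ≤ C * ‖x‖) : IsQuasiGreedy b := by
  intro x π hπ
  have hlim : Tendsto (fun n => (C + 1) * ‖x - SchauderBasis.proj b n x‖) atTop (𝓝 0) := by
    have h := ((tendsto_const_nhds (x := x)).sub (SchauderBasis.tendsto_proj b x)).norm
    simpa using h.const_mul (C + 1)
  rw [tendsto_iff_norm_sub_tendsto_zero]
  refine Metric.tendsto_atTop.2 fun ε hε => ?_
  obtain ⟨n, hn⟩ := ((tendsto_order.1 hlim).2 ε hε).exists
  have hev : ∀ᶠ N in atTop, ∀ i ∈ Finset.range n, b.coord i x ≠ 0 →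
      i ∈ (Finset.range N).map ⟨π, hπ.1⟩ := by
    rw [Filter.eventually_all_finset]
    intro i _
    by_cases h0 : b.coord i x = 0
    · simp [h0]
    · obtain ⟨k, rfl⟩ := hπ.2.1 i h0
      filter_upwards [eventually_gt_atTop k] with N hN _
      exact Finset.mem_map.2 ⟨k, Finset.mem_range.2 hN, rfl⟩
  obtain ⟨M, hM⟩ := eventually_atTop.1 hev
  refine ⟨M, fun N hN => ?_⟩
  rw [Real.dist_0_eq_abs, abs_norm, greedySum_eq_proj b hπ.1]
  refine lt_of_le_of_lt ?_ hn
  set A := (Finset.range N).map ⟨π, hπ.1⟩ with hA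
  -- The tail `z` is small, and once the greedy sum has collected all non-null coefficients below
  -- `n`, its remaining indices form a greedy set for `z`.
  set z := x - SchauderBasis.proj b n x with hz
  have hzc : ∀ i, b.coord i z = if i < n then 0 else b.coord i x := by
    intro i
    rw [hz, map_sub, SchauderBasis.proj, coord_proj]
    by_cases h : i < n <;> simp [h]
  have h1 : GeneralSchauderBasis.proj b A x =
      SchauderBasis.proj b n x + GeneralSchauderBasis.proj b (A \ Finset.range n) z := by
    rw [GeneralSchauderBasis.proj_apply, GeneralSchauderBasis.proj_apply,
      SchauderBasis.proj_apply, ← Finset.sum_inter_add_sum_sdiff A (Finset.range n)]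
    congr 1
    · refine Finset.sum_subset Finset.inter_subset_right fun i hi hi' => ?_
      by_cases h0 : b.coord i x = 0
      · rw [h0, zero_smul]
      · exact absurd (Finset.mem_inter.2 ⟨hM N hN i hi h0, hi⟩) hi'
    · refine Finset.sum_congr rfl fun i hi => ?_
      have hin : ¬ i < n := fun h => (Finset.mem_sdiff.1 hi).2 (Finset.mem_range.2 h)
      rw [hzc, if_neg hin]
  have h2 : ‖GeneralSchauderBasis.proj b (A \ Finset.range n) z‖ ≤ C * ‖z‖ := by
    refine hC z _ fun i hi j hj => ?_
    have hin : ¬ i < n := fun h => (Finset.mem_sdiff.1 hi).2 (Finset.mem_range.2 h)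
    rw [hzc, hzc i, if_neg hin]
    split_ifs with hjn
    · rw [norm_zero]; exact norm_nonneg _
    · refine hπ.norm_coord_le (Finset.mem_sdiff.1 hi).1 fun hjA => hj ?_
      exact Finset.mem_sdiff.2 ⟨hjA, fun h => hjn (Finset.mem_range.1 h)⟩
  rw [h1]
  calc _ = ‖GeneralSchauderBasis.proj b (A \ Finset.range n) z - z‖ := by
        congr 1; rw [hz]; abel
    _ ≤ C * ‖z‖ + ‖z‖ := (norm_sub_le _ _).trans (by gcongr)
    _ = (C + 1) * ‖z‖ := by ring

/-- The coefficients missed by a greedy set `A` are dominated by those it has in excess. -/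
lemma sum_sdiff_norm_coord_le {b : SchauderBasis 𝕜 X} {x : X} {A B : Finset ℕ}
    (hA : ∀ i ∈ A, ∀ j ∉ A, ‖b.coord j x‖ ≤ ‖b.coord i x‖) (hAB : B.card ≤ A.card) :
    ∑ i ∈ B \ A, ‖b.coord i x‖ ≤ ∑ i ∈ A \ B, ‖b.coord i x‖ := by
  have hcard : (B \ A).card ≤ (A \ B).card := by
    have h1 := Finset.card_sdiff_add_card_inter B A
    have h2 := Finset.card_sdiff_add_card_inter A B
    rw [Finset.inter_comm] at h2
    omega
  rcases (A \ B).eq_empty_or_nonempty with h | h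
  · rw [h, Finset.card_empty, Nat.le_zero, Finset.card_eq_zero] at hcard
    rw [h, hcard]
  · obtain ⟨k, hk, hmin⟩ := Finset.exists_min_image _ (fun i => ‖b.coord i x‖) h
    calc _ ≤ (B \ A).card • ‖b.coord k x‖ := Finset.sum_le_card_nsmul _ _ _ fun j hj =>
          hA k (Finset.mem_sdiff.1 hk).1 j (Finset.mem_sdiff.1 hj).2
      _ ≤ (A \ B).card • ‖b.coord k x‖ := by gcongr
      _ ≤ _ := Finset.card_nsmul_le_sum _ _ _ hmin

/-- If all vectors have unconditional expansions, then the projections are uniformly bounded. -/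
lemma exists_norm_proj_le_of_summable [CompleteSpace X] (b : SchauderBasis 𝕜 X)
    (h : ∀ x : X, Summable fun n : ℕ => b.coord n x • b n) :
    ∃ C : ℝ, ∀ A : Finset ℕ, ‖GeneralSchauderBasis.proj b A‖ ≤ C := by
  -- The unordered sum must agree with the limit of the ordered partial sums, so `b` is an
  -- unconditional basis and its projections are uniformly bounded.
  let u : UnconditionalSchauderBasis ℕ 𝕜 X :=
    { basis := b.basis
      coord := b.coord
      ortho := b.ortho
      expansion := fun x => by
        obtain ⟨y, hy⟩ := h x
        have h1 := SchauderBasis.tendsto_proj b x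
        simp only [SchauderBasis.proj_apply] at h1
        rwa [← tendsto_nhds_unique h1 hy.tendsto_sum_nat] at hy }
  exact u.exists_norm_proj_le

/-- An enumeration of `ℕ` that starts with the elements of `A` is a greedy ordering as soon as the
coefficients on `A` are equal and dominate, and the others decrease. -/
lemma exists_isGreedyOrdering (b : SchauderBasis 𝕜 X) {x : X} {A : Finset ℕ} {t : ℝ}
    (hA : ∀ i ∈ A, ‖b.coord i x‖ = t) (hle : ∀ i ∉ A, ‖b.coord i x‖ ≤ t)
    (hanti : ∀ i ∉ A, ∀ j ∉ A, i ≤ j → ‖b.coord j x‖ ≤ ‖b.coord i x‖) :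
    ∃ π, IsGreedyOrdering b x π ∧ ∀ y, greedySum b π A.card y =
      GeneralSchauderBasis.proj b A y := by
  set f := fun k : ℕ => Nat.nth (· ∈ A) k
  set g := fun k : ℕ => Nat.nth (· ∉ A) k
  have hfin : (Set.ofPred (· ∈ A)).Finite := A.finite_toSet
  have hinf : (Set.ofPred (· ∉ A)).Infinite := A.finite_toSet.infinite_compl
  have hcard : hfin.toFinset.card = A.card := by
    congr 1; ext; simp
  have hf : ∀ k, k < A.card → f k ∈ A := fun k hk =>
    Nat.nth_mem_of_lt_card hfin (by rwa [hcard])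
  have hg : ∀ k, g k ∉ A := fun k => Nat.nth_mem_of_infinite hinf k
  have hfinj : ∀ k < A.card, ∀ l < A.card, f k = f l → k = l := fun k hk l hl h =>
    Nat.nth_injOn hfin (by rw [hcard]; exact hk) (by rw [hcard]; exact hl) h
  -- `Nat.nth` on the finite set `A` returns a default value from `A.card` on, hence the switch to
  -- the complement.
  set π : ℕ → ℕ := fun k => if k < A.card then f k else g (k - A.card) with hπ
  have hinj : Function.Injective π := by
    intro k l hkl
    simp only [hπ] at hkl
    split_ifs at hkl with hk hl hl
    · exact hfinj k hk l hl hkl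
    · exact absurd (hkl ▸ hf k hk) (hg _)
    · exact absurd (hkl ▸ hf l hl) (hg _)
    · have := Nat.nth_injective hinf hkl
      omega
  have hmap : (Finset.range A.card).map ⟨π, hinj⟩ = A := by
    refine Finset.eq_of_subset_of_card_le (fun i hi => ?_) (by simp)
    obtain ⟨k, hk, rfl⟩ := Finset.mem_map.1 hi
    have hk := Finset.mem_range.1 hk
    simpa [hπ, hk] using hf k hk
  refine ⟨π, ⟨hinj, fun i _ => ?_, fun k => ?_⟩, fun y => ?_⟩
  · by_cases hi : i ∈ A
    · rw [← hmap] at hi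
      obtain ⟨k, _, rfl⟩ := Finset.mem_map.1 hi
      exact ⟨k, rfl⟩
    · have : i ∈ Set.range g := by
        rw [Nat.range_nth_of_infinite hinf]; exact hi
      obtain ⟨k, rfl⟩ := this
      exact ⟨k + A.card, by simp [hπ]⟩
  · simp only [hπ]
    by_cases hk : k + 1 < A.card
    · rw [if_pos hk, if_pos (by omega), hA _ (hf _ hk), hA _ (hf k (by omega))]
    · rw [if_neg hk]
      split_ifs with hk'
      · rw [hA _ (hf k hk')]; exact hle _ (hg _)
      · exact hanti _ (hg _) _ (hg _) (Nat.nth_monotone hinf (by omega))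
  · rw [greedySum_eq_proj b hinj, hmap]

end Greedy

section Lindenstrauss

variable {𝕜 : Type*} [RCLike 𝕜]

/-! ### Upper estimates -/

lemma coe_apply_eq (x : lindenstraussSpace 𝕜) (m : ℕ) :
    x.1 m = treeCoeff m x.1 - 1 / 2 * treeCoeff (m / 2) x.1 :=
  apply_eq_treeCoeff_sub (apply_zero_of_mem_lindenstraussSpace x.2) m

lemma treeCoeff_proj (A : Finset ℕ) (x : lindenstraussSpace 𝕜) (m : ℕ) :
    treeCoeff m (GeneralSchauderBasis.proj lindenstraussBasis A x).1 =
      if m - 1 ∈ A then treeCoeff m x.1 else 0 := by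
  cases m with
  | zero => simp
  | succ k => exact coord_proj lindenstraussBasis A x k

lemma norm_lindenstraussBasis_le (n : ℕ) : ‖(lindenstraussBasis n : lindenstraussSpace 𝕜)‖ ≤ 2 := by
  have hu : ∀ k, ‖unitVec 𝕜 k‖ = 1 := fun k => by
    rw [unitVec, lp.norm_single (by simp), norm_one]
  rw [Submodule.coe_norm, coe_lindenstraussBasis, lindenstraussVec]
  have h1 := norm_sub_le (unitVec 𝕜 (n + 1))
    ((1 / 2 : 𝕜) • (unitVec 𝕜 (2 * (n + 1)) + unitVec 𝕜 (2 * (n + 1) + 1)))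
  have h2 := norm_add_le (unitVec 𝕜 (2 * (n + 1))) (unitVec 𝕜 (2 * (n + 1) + 1))
  rw [norm_smul, hu] at h1
  rw [hu, hu] at h2
  have h3 : ‖(1 / 2 : 𝕜)‖ = 1 / 2 := by simp
  rw [h3] at h1
  linarith

lemma norm_sum_smul_lindenstraussBasis_le (A : Finset ℕ) (c : ℕ → 𝕜) :
    ‖∑ i ∈ A, c i • (lindenstraussBasis i : lindenstraussSpace 𝕜)‖ ≤ 2 * ∑ i ∈ A, ‖c i‖ := by
  rw [Finset.mul_sum]
  refine norm_sum_le_of_le _ fun i _ => ?_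
  rw [norm_smul, mul_comm]
  gcongr
  exact norm_lindenstraussBasis_le i

lemma sum_norm_coord_le (x : lindenstraussSpace 𝕜) (A : Finset ℕ) {L : ℕ} (hA : A.card ≤ 2 ^ L) :
    ∑ i ∈ A, ‖lindenstraussBasis.coord i x‖ ≤ (L + 1) * ‖x‖ := by
  have h := sum_norm_treeCoeff_le x.1 (A.map (addRightEmbedding 1)) (L := L) (by simpa using hA)
  rwa [Finset.sum_map] at h

lemma norm_proj_lindenstraussBasis_apply_le (x : lindenstraussSpace 𝕜) (A : Finset ℕ) {L : ℕ}
    (hA : A.card ≤ 2 ^ L) :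
    ‖GeneralSchauderBasis.proj lindenstraussBasis A x‖ ≤ 2 * ((L + 1) * ‖x‖) := by
  rw [GeneralSchauderBasis.proj_apply]
  refine (norm_sum_smul_lindenstraussBasis_le A _).trans ?_
  gcongr
  exact sum_norm_coord_le x A hA

/-- The projections onto greedy sets are uniformly bounded. -/
lemma norm_proj_le_of_greedy (x : lindenstraussSpace 𝕜) (A : Finset ℕ)
    (hA : ∀ i ∈ A, ∀ j ∉ A, ‖lindenstraussBasis.coord j x‖ ≤ ‖lindenstraussBasis.coord i x‖) :
    ‖GeneralSchauderBasis.proj lindenstraussBasis A x‖ ≤ 4 * ‖x‖ := by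
  set a : ℕ → 𝕜 := fun m => treeCoeff m x.1 with ha
  have ha0 : a 0 = 0 := treeCoeff_zero _
  -- Basis index `i` is node `i + 1`. At `m = 0` the truncated `m - 1` tests membership of `0`,
  -- which is harmless since `a 0 = 0`.
  set α : ℕ → ℝ := fun m => if m - 1 ∈ A then ‖a m‖ else 0 with hα
  have hα0 : ∀ m, 0 ≤ α m := fun m => by
    simp only [hα]; split_ifs <;> positivity
  have hgr : ∀ m n, m - 1 ∈ A → n - 1 ∉ A → m ≠ 0 → ‖a n‖ ≤ ‖a m‖ := by
    intro m n hm hn hm0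
    rcases Nat.eq_zero_or_pos n with rfl | hn0
    · rw [ha0, norm_zero]; exact norm_nonneg _
    · have h := hA _ hm _ hn
      rw [lindenstraussBasis_coord, lindenstraussBasis_coord, Nat.sub_add_cancel hn0,
        Nat.sub_add_cancel (Nat.pos_of_ne_zero hm0)] at h
      exact h
  -- Summed over `range (2 * n)`, the two `α` terms give the sum of `α` over `range n` minus that
  -- over `range (2 * n)`, which is at most `0`.
  have hpt : ∀ m, ‖(GeneralSchauderBasis.proj lindenstraussBasis A x).1 m‖ ≤
      4 * ‖x.1 m‖ + 1 / 2 * α (m / 2) - α m := by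
    intro m
    rw [coe_apply_eq, treeCoeff_proj, treeCoeff_proj, coe_apply_eq]
    change ‖(if m - 1 ∈ A then a m else 0) - 1 / 2 * (if m / 2 - 1 ∈ A then a (m / 2) else 0)‖ ≤
      4 * ‖a m - 1 / 2 * a (m / 2)‖ + 1 / 2 * α (m / 2) - α m
    have h2 : ‖(1 / 2 : 𝕜) * a (m / 2)‖ = 1 / 2 * ‖a (m / 2)‖ := by rw [norm_mul]; simp
    have htri := norm_sub_norm_le (a m) (1 / 2 * a (m / 2))
    rw [h2] at htri
    have hnn := norm_nonneg (a m - 1 / 2 * a (m / 2))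
    simp only [hα]
    by_cases h1 : m - 1 ∈ A <;> by_cases h3 : m / 2 - 1 ∈ A <;>
      simp only [h1, h3, if_true, if_false, mul_zero, sub_zero, zero_sub, norm_neg, norm_zero, h2,
        add_zero]
    · linarith
    · rcases Nat.eq_zero_or_pos m with rfl | hm
      · simp [ha0]
      -- Greediness gives `‖a (m / 2)‖ ≤ ‖a m‖`, so `‖x m‖ ≥ ‖a m‖ / 2`; the factor `4` pays for two
      -- copies of `‖a m‖`.
      · linarith [hgr m (m / 2) h1 h3 hm.ne']
    · linarith
    · linarith
  rw [Submodule.coe_norm]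
  refine norm_le_of_sum_range_two_mul_le fun n => ?_
  refine (Finset.sum_le_sum fun m _ => hpt m).trans ?_
  rw [Finset.sum_sub_distrib, Finset.sum_add_distrib, ← Finset.mul_sum, ← Finset.mul_sum,
    sum_range_mul_div α two_pos, nsmul_eq_mul]
  have h1 : ∑ m ∈ Finset.range n, α m ≤ ∑ m ∈ Finset.range (2 * n), α m :=
    Finset.sum_le_sum_of_subset_of_nonneg (Finset.range_subset_range.2 (by omega))
      fun _ _ _ => hα0 _
  have h2 := sum_norm_apply_le x.1 (Finset.range (2 * n))
  rw [Submodule.coe_norm]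
  push_cast
  linarith

/-- The greedy approximation is within a factor `4 L + 7` of the best one. -/
lemma norm_sub_proj_le_of_greedy {x y : lindenstraussSpace 𝕜} {A B : Finset ℕ} {L : ℕ}
    (hA : ∀ i ∈ A, ∀ j ∉ A, ‖lindenstraussBasis.coord j x‖ ≤ ‖lindenstraussBasis.coord i x‖)
    (hAL : A.card ≤ 2 ^ L) (hBA : B.card ≤ A.card)
    (hy : ∀ i, i ∉ B → lindenstraussBasis.coord i y = 0) :
    ‖x - GeneralSchauderBasis.proj lindenstraussBasis A x‖ ≤ (4 * L + 7) * ‖x - y‖ := by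
  set z := x - y with hz
  have hyP : GeneralSchauderBasis.proj lindenstraussBasis (A ∪ B) y = y :=
    proj_eq_self_of_coord_eq_zero _ fun i hi => hy i fun h => hi (Finset.mem_union_right _ h)
  have hdec : x - GeneralSchauderBasis.proj lindenstraussBasis A x =
      (z - GeneralSchauderBasis.proj lindenstraussBasis (A ∪ B) z) +
        GeneralSchauderBasis.proj lindenstraussBasis (B \ A) x := by
    have h : GeneralSchauderBasis.proj lindenstraussBasis (A ∪ B) x =
        GeneralSchauderBasis.proj lindenstraussBasis A x +
          GeneralSchauderBasis.proj lindenstraussBasis (B \ A) x := by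
      simp only [GeneralSchauderBasis.proj_apply]
      rw [← Finset.sum_union Finset.disjoint_sdiff, Finset.union_sdiff_self_eq_union]
    rw [hz, map_sub, hyP, h]
    abel
  have h1 : ‖GeneralSchauderBasis.proj lindenstraussBasis (A ∪ B) z‖ ≤
      2 * (((L + 1 : ℕ) + 1) * ‖z‖) := by
    refine norm_proj_lindenstraussBasis_apply_le z _ ?_
    have := Finset.card_union_le A B
    rw [pow_succ]
    omega
  have h2 : ‖GeneralSchauderBasis.proj lindenstraussBasis (B \ A) x‖ ≤ 2 * ((L + 1) * ‖z‖) := by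
    rw [GeneralSchauderBasis.proj_apply]
    refine (norm_sum_smul_lindenstraussBasis_le _ _).trans ?_
    gcongr
    refine (sum_sdiff_norm_coord_le hA hBA).trans ?_
    -- On `A \ B` the vector `y` has null coefficients, so those of `x` and `z` agree.
    rw [Finset.sum_congr rfl (g := fun i => ‖lindenstraussBasis.coord i z‖)]
    · exact sum_norm_coord_le z _ ((Finset.card_le_card Finset.sdiff_subset).trans hAL)
    · intro i hi
      rw [hz, map_sub, hy i (Finset.mem_sdiff.1 hi).2, sub_zero]
  rw [hdec]
  have h3 := norm_add_le (z - GeneralSchauderBasis.proj lindenstraussBasis (A ∪ B) z)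
    (GeneralSchauderBasis.proj lindenstraussBasis (B \ A) x)
  have h4 := norm_sub_le z (GeneralSchauderBasis.proj lindenstraussBasis (A ∪ B) z)
  push_cast at h1
  linarith

/-! ### Democracy -/

/-- At a node of the set the coordinate is `1` or `1 - 1/2`, according to whether its parent is
selected. -/
lemma le_norm_sum_lindenstraussBasis (A : Finset ℕ) :
    (A.card : ℝ) / 2 ≤ ‖∑ i ∈ A, (lindenstraussBasis i : lindenstraussSpace 𝕜)‖ := by
  set y := ∑ i ∈ A, (lindenstraussBasis i : lindenstraussSpace 𝕜) with hy
  have hc : ∀ m, treeCoeff m y.1 = if m ≠ 0 ∧ m - 1 ∈ A then 1 else 0 := by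
    intro m
    cases m with
    | zero => simp
    | succ k =>
      have h := coord_sum_smul (lindenstraussBasis (𝕜 := 𝕜)) A (fun _ => 1) k
      simp only [one_smul] at h
      exact h.trans (by simp)
  rw [Submodule.coe_norm]
  refine le_trans ?_ (sum_norm_apply_le y.1 (A.map (addRightEmbedding 1)))
  rw [Finset.sum_map]
  refine le_trans (le_of_eq ?_) (Finset.card_nsmul_le_sum A _ (1 / 2) fun i hi => ?_)
  · rw [nsmul_eq_mul]; ring
  · change 1 / 2 ≤ ‖y.1 (i + 1)‖
    rw [coe_apply_eq, hc, hc, if_pos ⟨by omega, by simpa using hi⟩]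
    split_ifs
    · have : ‖(1 - 1 / 2 * 1 : 𝕜)‖ = 1 / 2 := by
        rw [show (1 - 1 / 2 * 1 : 𝕜) = 1 / 2 by norm_num]; simp
      rw [this]
    · simp; norm_num

lemma isDemocratic_lindenstraussBasis : IsDemocratic (lindenstraussBasis (𝕜 := 𝕜)) := by
  refine ⟨4, fun N => iSup₂_le fun n _ => ENNReal.div_le_of_le_mul ?_⟩
  have hr : rightDemocracy (lindenstraussBasis (𝕜 := 𝕜)) n ≤ ENNReal.ofReal (4 * (n / 2)) := by
    refine iSup₂_le fun A hA => ?_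
    rw [← ofReal_norm]
    refine ENNReal.ofReal_le_ofReal ?_
    have h := norm_sum_smul_lindenstraussBasis_le (𝕜 := 𝕜) A fun _ => 1
    simp only [one_smul, norm_one, Finset.sum_const, hA, nsmul_eq_mul, mul_one] at h
    linarith
  have hl : ENNReal.ofReal (n / 2) ≤ leftDemocracy (lindenstraussBasis (𝕜 := 𝕜)) n := by
    refine le_iInf₂ fun A hA => ?_
    rw [← ofReal_norm]
    refine ENNReal.ofReal_le_ofReal ?_
    rw [← hA]
    exact le_norm_sum_lindenstraussBasis A
  refine hr.trans ?_
  rw [ENNReal.ofReal_mul (by norm_num)]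
  gcongr

/-! ### Lower estimates -/

lemma sum_Ico_one_two_pow (L : ℕ) :
    ∑ m ∈ Finset.Ico 1 (2 ^ L), (1 / 2 : ℝ) ^ Nat.log 2 m = L := by
  induction L with
  | zero => simp
  | succ L ih =>
    rw [← Finset.sum_Ico_consecutive _ (Nat.one_le_two_pow (n := L))
      (Nat.pow_le_pow_right two_pos L.le_succ), ih,
      Finset.sum_congr rfl (g := fun _ => (1 / 2 : ℝ) ^ L)]
    · rw [Finset.sum_const, Nat.card_Ico, pow_succ, mul_two, Nat.add_sub_cancel, nsmul_eq_mul]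
      push_cast
      rw [← mul_pow]; norm_num
    · intro m hm
      rw [Finset.mem_Ico] at hm
      rw [(Nat.log_eq_iff (Or.inr ⟨one_lt_two, by have := Nat.one_le_two_pow (n := L); omega⟩)).2 hm]

/-- The coefficients `2 ^ (-d)` on the levels `d < L` of the binary tree. -/
noncomputable def treeWeight (L m : ℕ) : ℝ :=
  if 0 < m ∧ m < 2 ^ L then (1 / 2) ^ Nat.log 2 m else 0

lemma treeWeight_nonneg (L m : ℕ) : 0 ≤ treeWeight L m := by
  unfold treeWeight; split_ifs <;> positivity

lemma treeWeight_le_one (L m : ℕ) : treeWeight L m ≤ 1 := by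
  unfold treeWeight
  split_ifs
  · exact pow_le_one₀ (by norm_num) (by norm_num)
  · norm_num

lemma treeWeight_anti (L : ℕ) {m n : ℕ} (hm : 0 < m) (hmn : m ≤ n) :
    treeWeight L n ≤ treeWeight L m := by
  by_cases hn : n < 2 ^ L
  · rw [treeWeight, treeWeight, if_pos ⟨hm.trans_le hmn, hn⟩, if_pos ⟨hm, hmn.trans_lt hn⟩]
    exact pow_le_pow_of_le_one (by norm_num) (by norm_num) (Nat.log_mono_right hmn)
  · rw [treeWeight, if_neg fun h => hn h.2]
    exact treeWeight_nonneg L m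

variable (𝕜) in
/-- The truncation to `L` levels of the formal expansion of the first unit vector. -/
noncomputable def treeVec (L : ℕ) : lindenstraussSpace 𝕜 :=
  ∑ i ∈ Finset.range (2 ^ L), (treeWeight L (i + 1) : 𝕜) • lindenstraussBasis i

lemma coord_treeVec (L i : ℕ) :
    lindenstraussBasis.coord i (treeVec 𝕜 L) = (treeWeight L (i + 1) : 𝕜) := by
  rw [treeVec, coord_sum_smul lindenstraussBasis _ fun i => (treeWeight L (i + 1) : 𝕜)]
  split_ifs with h
  · rfl
  · rw [treeWeight, if_neg (by rw [Finset.mem_range] at h; omega)]; simp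

lemma treeCoeff_treeVec (L m : ℕ) : treeCoeff m (treeVec 𝕜 L).1 = (treeWeight L m : 𝕜) := by
  cases m with
  | zero => simp [treeWeight]
  | succ k => exact coord_treeVec L k

lemma treeWeight_half (L : ℕ) {m : ℕ} (hm : 2 ≤ m) (hmL : m < 2 ^ L) :
    1 / 2 * treeWeight L (m / 2) = treeWeight L m := by
  rw [treeWeight, treeWeight, if_pos ⟨by omega, by omega⟩, if_pos ⟨by omega, hmL⟩,
    Nat.log_of_one_lt_of_le one_lt_two hm, pow_succ]
  ring

/-- Inside the tree each weight is half its parent's and cancels. At most `1` remains at the root,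
and at most `2⁻ᴸ` at each of the `2 ^ L` nodes of level `L`. -/
lemma norm_treeVec_le (L : ℕ) : ‖treeVec 𝕜 L‖ ≤ 2 := by
  have hpow : 1 ≤ 2 ^ L := Nat.one_le_two_pow
  have hpt : ∀ m, ‖(treeVec 𝕜 L).1 m‖ ≤ (if m = 1 then 1 else 0) +
      (if m ∈ Finset.Ico (2 ^ L) (2 ^ (L + 1)) then (1 / 2 : ℝ) ^ L else 0) := by
    intro m
    have hn2 : (0 : ℝ) ≤ if m ∈ Finset.Ico (2 ^ L) (2 ^ (L + 1)) then (1 / 2 : ℝ) ^ L else 0 := by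
      split_ifs <;> positivity
    have hreal : ‖(treeVec 𝕜 L).1 m‖ = |treeWeight L m - 1 / 2 * treeWeight L (m / 2)| := by
      rw [coe_apply_eq, treeCoeff_treeVec, treeCoeff_treeVec, ← RCLike.norm_ofReal (K := 𝕜)]
      push_cast
      rfl
    rw [hreal]
    have h0 : treeWeight L 0 = 0 := by simp [treeWeight]
    rcases Nat.lt_or_ge m 2 with hm | hm
    · have hm2 : m / 2 = 0 := by omega
      rw [hm2, h0, mul_zero, sub_zero, abs_of_nonneg (treeWeight_nonneg _ _)]
      rcases Nat.eq_zero_or_pos m with rfl | hm0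
      · rw [h0, if_neg (by omega)]; linarith
      · rw [if_pos (by omega)]
        linarith [treeWeight_le_one L m]
    · rw [if_neg (by omega), zero_add]
      by_cases hmL : m < 2 ^ L
      · rw [treeWeight_half L hm hmL, sub_self, abs_zero]; exact hn2
      · rw [treeWeight, if_neg (by omega), zero_sub, abs_neg]
        by_cases hmL' : m < 2 ^ (L + 1)
        · have hlog : Nat.log 2 m = L :=
            (Nat.log_eq_iff (Or.inr ⟨one_lt_two, by omega⟩)).2 ⟨not_lt.1 hmL, hmL'⟩
          rw [if_pos (Finset.mem_Ico.2 ⟨not_lt.1 hmL, hmL'⟩), treeWeight,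
            if_pos ⟨by omega, by rw [pow_succ] at hmL'; omega⟩, ← hlog,
            Nat.log_of_one_lt_of_le one_lt_two hm, pow_succ, abs_of_nonneg (by positivity)]
          linarith
        · rw [treeWeight, if_neg (by rw [pow_succ] at hmL'; omega), mul_zero, abs_zero]
          exact hn2
  rw [Submodule.coe_norm]
  refine norm_le_of_sum_range_two_mul_le fun n => ?_
  refine (Finset.sum_le_sum fun m _ => hpt m).trans ?_
  rw [Finset.sum_add_distrib]
  have h1 : ∑ m ∈ Finset.range (2 * n), (if m = 1 then 1 else 0 : ℝ) ≤ 1 := by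
    rw [Finset.sum_ite_eq']; split_ifs <;> norm_num
  have h2 : ∑ m ∈ Finset.range (2 * n),
      (if m ∈ Finset.Ico (2 ^ L) (2 ^ (L + 1)) then (1 / 2 : ℝ) ^ L else 0) ≤ 1 := by
    rw [Finset.sum_ite_mem]
    refine (Finset.sum_le_sum_of_subset_of_nonneg Finset.inter_subset_right
      fun _ _ _ => by positivity).trans_eq ?_
    rw [Finset.sum_const, Nat.card_Ico, pow_succ, mul_two, Nat.add_sub_cancel, nsmul_eq_mul]
    push_cast
    rw [← mul_pow]; norm_num
  linarith

/-- Retaining the even levels of the tree only makes the norm large. -/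
lemma le_norm_of_coord_even {L : ℕ} {w : lindenstraussSpace 𝕜}
    (hw : ∀ i, i + 1 < 2 ^ L → lindenstraussBasis.coord i w =
      if Even (Nat.log 2 (i + 1)) then (treeWeight L (i + 1) : 𝕜) else 0) : (L : ℝ) ≤ ‖w‖ := by
  rw [← sum_Ico_one_two_pow L, Submodule.coe_norm]
  refine le_trans (Finset.sum_le_sum fun m hm => ?_) (sum_norm_apply_le w.1 _)
  obtain ⟨hm1, hm2⟩ := Finset.mem_Ico.1 hm
  have hc : ∀ k, 0 < k → k < 2 ^ L → treeCoeff k w.1 =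
      if Even (Nat.log 2 k) then (treeWeight L k : 𝕜) else 0 := by
    intro k hk hkL
    have h := hw (k - 1) (by omega)
    rwa [lindenstraussBasis_coord, Nat.sub_add_cancel hk] at h
  have hval : (1 / 2 : ℝ) ^ Nat.log 2 m = treeWeight L m := by
    rw [treeWeight, if_pos ⟨hm1, hm2⟩]
  rw [hval, coe_apply_eq, hc m hm1 hm2]
  rcases Nat.lt_or_ge m 2 with h | h
  · obtain rfl : m = 1 := by omega
    simp [abs_of_nonneg (treeWeight_nonneg L 1)]
  · rw [hc (m / 2) (by omega) (by omega)]
    have hlog := Nat.log_of_one_lt_of_le one_lt_two h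
    -- Exactly one of a node and its parent is kept, so the coordinate has modulus `treeWeight L m`
    -- either way.
    by_cases he : Even (Nat.log 2 m)
    · have ho : ¬ Even (Nat.log 2 (m / 2)) := fun h' => by
        rw [hlog, Nat.even_add_one] at he; exact he h'
      rw [if_pos he, if_neg ho, mul_zero, sub_zero, RCLike.norm_ofReal,
        abs_of_nonneg (treeWeight_nonneg _ _)]
    · have ho : Even (Nat.log 2 (m / 2)) := by
        rw [hlog, Nat.even_add_one, not_not] at he; exact he
      rw [if_neg he, if_pos ho, zero_sub, norm_neg, norm_mul, RCLike.norm_ofReal,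
        abs_of_nonneg (treeWeight_nonneg _ _), ← treeWeight_half L h hm2]
      simp

end Lindenstrauss

section Lindenstrauss

variable {𝕜 : Type*} [RCLike 𝕜]

/-- The odd levels of the tree can be the largest coefficients of a vector that differs from the
tree vector on these levels only, up to indices beyond the tree. -/
lemma exists_isGreedyOrdering_treeVec {L N : ℕ} (hLN : 2 ^ L ≤ N) :
    ∃ (x : lindenstraussSpace 𝕜) (π : ℕ → ℕ), IsGreedyOrdering lindenstraussBasis x π ∧
      (L : ℝ) ≤ ‖x - greedySum lindenstraussBasis π N x‖ ∧
      ∃ y ∈ nTermSet (lindenstraussBasis (𝕜 := 𝕜)) N, ‖x - y‖ ≤ 2 := by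
  have hpow : 1 ≤ 2 ^ L := Nat.one_le_two_pow
  set O := (Finset.range (2 ^ L - 1)).filter fun i => ¬ Even (Nat.log 2 (i + 1)) with hO
  have hOcard : O.card ≤ N := by
    have : O.card ≤ 2 ^ L - 1 := (Finset.card_filter_le _ _).trans_eq (Finset.card_range _)
    omega
  -- Indices from `2 ^ L - 1` on lie beyond the tree; they pad the odd levels to exactly `N`
  -- elements.
  set A := O ∪ Finset.Ico (2 ^ L - 1) (2 ^ L - 1 + (N - O.card)) with hA
  have hAcard : A.card = N := by
    rw [hA, Finset.card_union_of_disjoint, Nat.card_Ico]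
    · omega
    · refine Finset.disjoint_left.2 fun i hi hi' => ?_
      have h1 := Finset.mem_range.1 (Finset.mem_filter.1 hi).1
      have h2 := (Finset.mem_Ico.1 hi').1
      omega
  have hmem : ∀ i, i + 1 < 2 ^ L → (i ∈ A ↔ ¬ Even (Nat.log 2 (i + 1))) := by
    intro i hi
    rw [hA, Finset.mem_union, hO, Finset.mem_filter, Finset.mem_range, Finset.mem_Ico]
    constructor
    · rintro (h | h)
      · exact h.2
      · omega
    · exact fun h => Or.inl ⟨by omega, h⟩
  -- This raises each coefficient on `A` to `2`, above all tree weights, which are at most `1`.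
  set c : ℕ → 𝕜 := fun i => 2 - (treeWeight L (i + 1) : 𝕜) with hc
  set y : lindenstraussSpace 𝕜 := ∑ i ∈ A, c i • lindenstraussBasis i with hy
  set x := treeVec 𝕜 L + y with hx
  have hyc : ∀ i, lindenstraussBasis.coord i y = if i ∈ A then c i else 0 :=
    coord_sum_smul lindenstraussBasis A c
  have hxc : ∀ i, lindenstraussBasis.coord i x =
      if i ∈ A then 2 else (treeWeight L (i + 1) : 𝕜) := by
    intro i
    rw [hx, map_add, coord_treeVec, hyc]
    split_ifs
    · rw [hc]; ring
    · rw [add_zero]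
  have hout : ∀ i ∉ A, ‖lindenstraussBasis.coord i x‖ = treeWeight L (i + 1) := fun i hi => by
    rw [hxc, if_neg hi, RCLike.norm_ofReal, abs_of_nonneg (treeWeight_nonneg _ _)]
  obtain ⟨π, hπ, hG⟩ := exists_isGreedyOrdering lindenstraussBasis (x := x) (A := A) (t := 2)
    (fun i hi => by rw [hxc, if_pos hi]; simp)
    (fun i hi => by rw [hout i hi]; linarith [treeWeight_le_one L (i + 1)])
    (fun i hi j hj hij => by
      rw [hout i hi, hout j hj]; exact treeWeight_anti L i.succ_pos (by omega))
  rw [hAcard] at hG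
  refine ⟨x, π, hπ, ?_, y, ⟨A, hAcard.le, fun i hi => by rw [hyc, if_neg hi]⟩, ?_⟩
  · rw [hG]
    refine le_norm_of_coord_even fun i hi => ?_
    rw [map_sub, coord_proj, hxc]
    by_cases h : i ∈ A
    · rw [if_pos h, if_pos h, sub_self, if_neg ((hmem i hi).1 h)]
    · rw [if_neg h, if_neg h, sub_zero, if_pos (not_not.1 fun h' => h ((hmem i hi).2 h'))]
  · rw [hx, add_sub_cancel_right]
    exact norm_treeVec_le L

variable (𝕜) in
lemma exists_le_norm_proj (L : ℕ) : ∃ A : Finset ℕ, A.card ≤ 2 ^ L ∧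
    (L : ℝ) / 2 ≤ ‖GeneralSchauderBasis.proj (lindenstraussBasis (𝕜 := 𝕜)) A‖ := by
  refine ⟨(Finset.range (2 ^ L)).filter fun i => Even (Nat.log 2 (i + 1)),
    (Finset.card_filter_le _ _).trans_eq (Finset.card_range _), ?_⟩
  set A := (Finset.range (2 ^ L)).filter fun i => Even (Nat.log 2 (i + 1)) with hA
  have h1 : (L : ℝ) ≤ ‖GeneralSchauderBasis.proj lindenstraussBasis A (treeVec 𝕜 L)‖ := by
    refine le_norm_of_coord_even fun i hi => ?_
    rw [coord_proj, coord_treeVec]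
    simp only [hA, Finset.mem_filter, Finset.mem_range, show i < 2 ^ L by omega, true_and]
  have h2 := (GeneralSchauderBasis.proj (lindenstraussBasis (𝕜 := 𝕜)) A).le_opNorm (treeVec 𝕜 L)
  have h3 := norm_treeVec_le (𝕜 := 𝕜) L
  have h4 := norm_nonneg (GeneralSchauderBasis.proj (lindenstraussBasis (𝕜 := 𝕜)) A)
  nlinarith

/-! ### Comparison with the logarithm -/

lemma log_le_two_mul_natLog {N : ℕ} (hN : 2 ≤ N) : Real.log N ≤ 2 * Nat.log 2 N := by
  have hL : (1 : ℝ) ≤ Nat.log 2 N := by exact_mod_cast Nat.log_pos one_lt_two hN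
  have h : (N : ℝ) ≤ 2 ^ (Nat.log 2 N + 1) := by
    exact_mod_cast (Nat.lt_pow_succ_log_self one_lt_two N).le
  have h1 := Real.log_le_log (by positivity) h
  rw [Real.log_pow] at h1
  push_cast at h1
  nlinarith [Real.log_two_lt_d9]

lemma natLog_le_two_mul_log {N : ℕ} (hN : 2 ≤ N) : (Nat.log 2 N : ℝ) ≤ 2 * Real.log N := by
  have h : (2 : ℝ) ^ Nat.log 2 N ≤ N := by
    exact_mod_cast Nat.pow_log_le_self 2 (by omega)
  have h1 := Real.log_le_log (by positivity) h
  rw [Real.log_pow] at h1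
  nlinarith [Real.log_two_gt_d9, Nat.cast_nonneg (α := ℝ) (Nat.log 2 N)]

lemma approxLog_projectionConst :
    ApproxLog fun N => projectionConst (lindenstraussBasis (𝕜 := 𝕜)) N := by
  refine ⟨1 / 4, 16, by norm_num, by norm_num, fun N hN => ⟨?_, ?_⟩⟩
  · obtain ⟨A, hA, hL⟩ := exists_le_norm_proj 𝕜 (Nat.log 2 N)
    refine le_trans ?_ (le_iSup₂_of_le A (hA.trans (Nat.pow_log_le_self 2 (by omega))) le_rfl)
    rw [← ofReal_norm]
    refine ENNReal.ofReal_le_ofReal ?_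
    linarith [log_le_two_mul_natLog hN]
  · refine iSup₂_le fun A hA => ?_
    rw [← ofReal_norm]
    refine ENNReal.ofReal_le_ofReal ?_
    have hL : (1 : ℝ) ≤ Nat.log 2 N := by exact_mod_cast Nat.log_pos one_lt_two hN
    have hlog := natLog_le_two_mul_log hN
    refine ContinuousLinearMap.opNorm_le_bound _ (by linarith) fun x => ?_
    refine (norm_proj_lindenstraussBasis_apply_le x A
      (hA.trans (Nat.lt_pow_succ_log_self one_lt_two N).le)).trans ?_
    rw [← mul_assoc]
    refine mul_le_mul_of_nonneg_right ?_ (norm_nonneg _)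
    push_cast
    linarith

lemma approxLog_lebesgueConst :
    ApproxLog fun N => lebesgueConst (lindenstraussBasis (𝕜 := 𝕜)) N := by
  refine ⟨1 / 4, 44, by norm_num, by norm_num, fun N hN => ?_⟩
  have hL : (1 : ℝ) ≤ Nat.log 2 N := by exact_mod_cast Nat.log_pos one_lt_two hN
  have hlog := natLog_le_two_mul_log hN
  have hlog' := log_le_two_mul_natLog hN
  refine ⟨?_, ?_⟩
  · obtain ⟨x, π, hπ, hx, y, hy, hxy⟩ :=
      exists_isGreedyOrdering_treeVec (𝕜 := 𝕜) (Nat.pow_log_le_self 2 (show N ≠ 0 by omega))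
    refine le_trans ?_ (le_iSup_of_le x (le_iSup₂_of_le π hπ le_rfl))
    have h1 : nTermError lindenstraussBasis N x ≤ ENNReal.ofReal 2 := by
      refine (iInf₂_le y hy).trans ?_
      rw [← ofReal_norm]
      exact ENNReal.ofReal_le_ofReal hxy
    have h2 : ENNReal.ofReal (Nat.log 2 N) ≤
        ‖x - greedySum lindenstraussBasis π N x‖ₑ := by
      rw [← ofReal_norm]
      exact ENNReal.ofReal_le_ofReal hx
    refine le_trans ?_ (ENNReal.div_le_div h2 h1)
    rw [← ENNReal.ofReal_div_of_pos two_pos]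
    exact ENNReal.ofReal_le_ofReal (by linarith)
  · refine iSup_le fun x => iSup₂_le fun π hπ => ENNReal.div_le_of_le_mul ?_
    have hpos : 0 < 44 * Real.log N := by linarith
    -- Dividing by the constant lets the infimum defining the `N`-term error be tested on each `y`;
    -- the multiplicative form also covers a zero error.
    rw [← ENNReal.div_le_iff' (ENNReal.ofReal_pos.2 hpos).ne' ENNReal.ofReal_ne_top]
    refine le_iInf₂ fun y hy => ?_
    obtain ⟨B, hB, hyB⟩ := hy
    rw [ENNReal.div_le_iff' (ENNReal.ofReal_pos.2 hpos).ne' ENNReal.ofReal_ne_top, ← ofReal_norm,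
      ← ofReal_norm, ← ENNReal.ofReal_mul hpos.le]
    refine ENNReal.ofReal_le_ofReal ?_
    rw [greedySum_eq_proj _ hπ.1]
    refine (norm_sub_proj_le_of_greedy (B := B) (L := Nat.log 2 N + 1)
      (fun i hi j hj => hπ.norm_coord_le hi hj) ?_ (by simpa using hB) hyB).trans ?_
    · simpa using (Nat.lt_pow_succ_log_self one_lt_two N).le
    · refine mul_le_mul_of_nonneg_right ?_ (norm_nonneg _)
      push_cast
      linarith

variable (𝕜) in
lemma exists_not_summable_lindenstraussBasis : ∃ x : lindenstraussSpace 𝕜,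
    ¬ Summable fun n : ℕ =>
      (lindenstraussBasis (𝕜 := 𝕜)).coord n x • lindenstraussBasis (𝕜 := 𝕜) n := by
  by_contra! h
  have : CompleteSpace (lindenstraussSpace 𝕜) :=
    (Submodule.isClosed_topologicalClosure _).completeSpace_coe
  obtain ⟨C, hC⟩ := exists_norm_proj_le_of_summable (lindenstraussBasis (𝕜 := 𝕜)) h
  obtain ⟨L, hL⟩ := exists_nat_gt (2 * C)
  obtain ⟨A, -, hA⟩ := exists_le_norm_proj 𝕜 L
  linarith [hC A]

end Lindenstrauss

theorem mainTheorem7 (𝕜 : Type*) [RCLike 𝕜] :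
    ∃ b : SchauderBasis 𝕜 (lindenstraussSpace 𝕜),
      (∀ n : ℕ, (b n : ℓ¹(ℕ, 𝕜)) = lindenstraussVec 𝕜 (n + 1)) ∧
      (∀ n : ℕ, ‖SchauderBasis.proj b n‖ ≤ 1) ∧
      IsQuasiGreedy b ∧
      IsDemocratic b ∧
      ApproxLog (fun N => projectionConst b N) ∧
      ApproxLog (fun N => lebesgueConst b N) ∧
      (∃ x : lindenstraussSpace 𝕜, ¬ Summable fun n : ℕ => b.coord n x • b n) :=
  ⟨lindenstraussBasis, coe_lindenstraussBasis, norm_lindenstraussBasis_proj_le,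
    isQuasiGreedy_of_norm_proj_le _ norm_proj_le_of_greedy, isDemocratic_lindenstraussBasis,
    approxLog_projectionConst, approxLog_lebesgueConst, exists_not_summable_lindenstraussBasis 𝕜⟩
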